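/- Let $d\in\mathbb{N}$. Graphs are finite, without loops or multiple edges; digraphs may have anti-parallel edges. The $FB(d)$-model consists of the digraphs all of whose in-degrees and out-degrees are at most $d$; an algorithm knows the vertex set $[n]$ and a query to a vertex $v$ returns the pair $(\Gamma^+(v),\Gamma^-(v))$ of the sets of its out-neighbours and in-neighbours. The undirected $d$-bounded degree model consists of the undirected graphs of maximum degree at most $d$; a query to $v$ returns its set of neighbours $\Gamma(v)$. In either model: A property $P=\bigcup_{n\in\mathbb{N}}P_n$ is a set of (di)graphs of the model that is closed under isomorphism, $P_n$ being its set of members on the vertex set $[n]$; it is monotone if $G\in P$ implies $G\setminus\{e\}\in P$ for every edge $e$ of $G$. The distance $\mathrm{dist}(G,G')$ of two graphs on $[n]$ is the number of edges that must be deleted or inserted to turn $G$ into $G'$. An $n$-vertex graph $G$ is $\epsilon$-close to a set $Q_n$ of $n$-vertex graphs if $\mathrm{dist}(G,G')\le\epsilon dn$ for some $G'\in Q_n$, and $\epsilon$-far from $Q_n$ otherwise; two sets of $n$-vertex graphs are $\epsilon$-close if every member of each is $\epsilon$-close to the other. $P$ is 1-sided error strongly testable if for every $\epsilon\in(0,1)$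 there is $q=q(\epsilon)\in\mathbb{N}$ such that for every $n$ there is a randomized adaptive query algorithm $T(\epsilon,n)$ (a probability distribution over deterministic adaptive query algorithms) which makes at most $q$ queries in every run on every $n$-vertex graph of the model, accepts every $G\in P_n$ with probability $1$, and rejects every $n$-vertex graph of the model that is $\epsilon$-far from $P_n$ with probability at least $1/2$. A set $\mathcal{H}$ of (di)graphs is an $r$-set if each member has at most $r$ vertices. Write $P_{\mathcal{H}}$ for the set of $n$-vertex graphs of the model with no (not necessarily induced) subgraph isomorphic to a member of $\mathcal{H}$. Theorem. (1) A monotone digraph property $P=\bigcup_n P_n$ in the $FB(d)$-model is 1-sided error strongly testable in the $FB(d)$-model if and only if for every $\epsilon>0$ there is $r=r(\epsilon)\in\mathbb{N}$ such that for every $n$ there is an $r$-set of digraphs $\mathcal{H}_n$ (which may depend on $\epsilon$ and need not be rooted) for which (a) $P_n\subseteq P_{\mathcal{H}_n}$, and (b) $P_{\mathcal{H}_n}$ is $\epsilon/2$-close to $P_n$. (2) The same equivalence holds for every monotone property of undirected graphs in the undirected $d$-bounded degree model, with $r$-sets $\mathcal{H}_n$ of undirected graphs. -/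

import Mathlib

namespace FBTesting

/-! ### Query algorithms and one-sided error tests -/

/-- A deterministic adaptive query algorithm on inputs with vertex set `V`, whose oracle answers a
vertex query by an element of `A`: it either halts with a verdict (`true` = accept,
`false` = reject), or queries a vertex and continues depending on the answer. -/
inductive QueryAlg (V A : Type) : Type
  | halt (verdict : Bool) : QueryAlg V A
  | query (v : V) (next : A → QueryAlg V A) : QueryAlg V A

namespace QueryAlg

variable {V A : Type}

/-- The verdict of the algorithm when its queries are answered by `oracle`. -/
def run (oracle : V → A) : QueryAlg V A → Bool
  | halt b => b
  | query v next => run oracle (next (oracle v))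

/-- The number of queries made in the run in which queries are answered by `oracle`. -/
def cost (oracle : V → A) : QueryAlg V A → ℕ
  | halt _ => 0
  | query v next => cost oracle (next (oracle v)) + 1

end QueryAlg

/-- `T`, a randomized query algorithm (a probability distribution over deterministic ones), is a
one-sided error test making at most `q` queries. Here `oracle G` is the query access to the input
`G`, `model` is the set of admissible inputs, `yes` the set of inputs to be accepted and `far` the
set of inputs to be rejected. The query bound holds for every admissible input and every run. -/
structure IsOneSidedTest {V A X : Type} (oracle : X → V → A) (model yes far : Set X) (q : ℕ)
    (T : PMF (QueryAlg V A)) : Prop where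
  query_le : ∀ G ∈ model, ∀ t ∈ T.support, t.cost (oracle G) ≤ q
  accepts : ∀ G ∈ model, G ∈ yes → T.map (fun t => t.run (oracle G)) true = 1
  rejects : ∀ G ∈ model, G ∈ far → 1 / 2 ≤ T.map (fun t => t.run (oracle G)) false

/-- `G` is `ε`-close to the set `S` of `n`-vertex graphs, with respect to the edit distance `dist`
in a model with degree bound `d`. (`G` is `ε`-far from `S` if it is not `ε`-close to `S`; in
particular every graph is `ε`-far from the empty set.) -/
def CloseTo {X : Type} (dist : X → X → ℕ) (d n : ℕ) (ε : ℝ) (G : X) (S : Set X) : Prop :=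
  ∃ G' ∈ S, (dist G G' : ℝ) ≤ ε * d * n

/-- The sets `S`, `S'` of `n`-vertex graphs are `ε`-close to each other. -/
def SetsClose {X : Type} (dist : X → X → ℕ) (d n : ℕ) (ε : ℝ) (S S' : Set X) : Prop :=
  (∀ G ∈ S, CloseTo dist d n ε G S') ∧ (∀ G ∈ S', CloseTo dist d n ε G S)

/-! ### Digraphs: the model with bounded in- and out-degree, forward and backward queries -/

/-- The set of out-neighbours of `v`. -/
def outNbrs {V : Type} (G : Digraph V) (v : V) : Set V := {u | G.Adj v u}

/-- The set of in-neighbours of `v`. -/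
def inNbrs {V : Type} (G : Digraph V) (v : V) : Set V := {u | G.Adj u v}

/-- The digraph has no loops (Mathlib's `Digraph` allows loops, but no multiple edges). -/
def Loopless {V : Type} (G : Digraph V) : Prop := ∀ v, ¬ G.Adj v v

/-- The `n`-vertex digraphs of the `FB(d)`-model: all in- and out-degrees are at most `d`. -/
def fbModel (d n : ℕ) : Set (Digraph (Fin n)) :=
  {G | Loopless G ∧ ∀ v, (outNbrs G v).ncard ≤ d ∧ (inNbrs G v).ncard ≤ d}

/-- Query access in the `FB(d)`-model: the answer to the query `v` consists of the out-neighbours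
and the in-neighbours of `v`. -/
def fbOracle {n : ℕ} (G : Digraph (Fin n)) (v : Fin n) : Set (Fin n) × Set (Fin n) :=
  (outNbrs G v, inNbrs G v)

/-- The set of (directed) edges. -/
def arcSet {V : Type} (G : Digraph V) : Set (V × V) := {e | G.Adj e.1 e.2}

/-- The number of edges to be deleted or inserted in order to turn `G` into `G'`. -/
noncomputable def diDist {V : Type} (G G' : Digraph V) : ℕ :=
  (symmDiff (arcSet G) (arcSet G')).ncard

/-- `G` with the single edge `(u, v)` deleted. -/
def deleteArc {V : Type} (G : Digraph V) (u v : V) : Digraph V where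
  Adj a b := G.Adj a b ∧ ¬ (a = u ∧ b = v)

/-- Isomorphism of digraphs. -/
def DiIso {V W : Type} (G : Digraph V) (G' : Digraph W) : Prop :=
  ∃ e : V ≃ W, ∀ u v, G.Adj u v ↔ G'.Adj (e u) (e v)

/-- `G` contains a (not necessarily induced) subgraph that is isomorphic to `H`. -/
def DiContains {V W : Type} (H : Digraph W) (G : Digraph V) : Prop :=
  ∃ φ : W → V, Function.Injective φ ∧ ∀ u v, H.Adj u v → G.Adj (φ u) (φ v)

/-- `P = ⋃ₙ P n` is a digraph property in the `FB(d)`-model; `P n` is its set of graphs with vertex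
set `Fin n`. -/
structure IsDiProperty (d : ℕ) (P : ∀ n : ℕ, Set (Digraph (Fin n))) : Prop where
  subset_model : ∀ n, P n ⊆ fbModel d n
  iso_closed : ∀ n (G G' : Digraph (Fin n)), DiIso G G' → G ∈ P n → G' ∈ P n

/-- The property is monotone (decreasing): it is preserved by the deletion of any edge. -/
def IsDiMonotone (P : ∀ n : ℕ, Set (Digraph (Fin n))) : Prop :=
  ∀ n, ∀ G ∈ P n, ∀ u v, G.Adj u v → deleteArc G u v ∈ P n

/-- `P` is one-sided error strongly-testable in the `FB(d)`-model: for every `ε ∈ (0, 1)` there are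
one-sided error `ε`-tests, one for each `n`, with query complexity independent of `n`. -/
def DiStronglyTestable (d : ℕ) (P : ∀ n : ℕ, Set (Digraph (Fin n))) : Prop :=
  ∀ ε : ℝ, 0 < ε → ε < 1 → ∃ q : ℕ, ∀ n : ℕ,
    ∃ T : PMF (QueryAlg (Fin n) (Set (Fin n) × Set (Fin n))),
      IsOneSidedTest fbOracle (fbModel d n) (P n) {G | ¬ CloseTo diDist d n ε G (P n)} q T

/-- A set of finite digraphs (up to isomorphism, digraphs with vertex set some `Fin k`) is an
`r`-set if each of its members has at most `r` vertices. -/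
def IsDiRSet (r : ℕ) (𝓗 : Set (Σ k : ℕ, Digraph (Fin k))) : Prop :=
  ∀ H ∈ 𝓗, H.1 ≤ r ∧ Loopless H.2

/-- The `n`-vertex digraphs of the `FB(d)`-model that are `𝓗`-free. -/
def diFree (d : ℕ) (𝓗 : Set (Σ k : ℕ, Digraph (Fin k))) (n : ℕ) : Set (Digraph (Fin n)) :=
  {G | G ∈ fbModel d n ∧ ∀ H ∈ 𝓗, ¬ DiContains H.2 G}

/-! ### Undirected graphs of bounded degree -/

/-- The `n`-vertex undirected graphs with all degrees at most `d`. -/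
def undirModel (d n : ℕ) : Set (SimpleGraph (Fin n)) :=
  {G | ∀ v, (G.neighborSet v).ncard ≤ d}

/-- Query access in the undirected model: the answer to the query `v` is the set of neighbours. -/
def undirOracle {n : ℕ} (G : SimpleGraph (Fin n)) (v : Fin n) : Set (Fin n) := G.neighborSet v

/-- The number of undirected edges to be deleted or inserted in order to turn `G` into `G'`. -/
noncomputable def undirDist {V : Type} (G G' : SimpleGraph V) : ℕ :=
  (symmDiff G.edgeSet G'.edgeSet).ncard

/-- `P = ⋃ₙ P n` is a property of undirected graphs of degree at most `d`. -/
structure IsUndirProperty (d : ℕ) (P : ∀ n : ℕ, Set (SimpleGraph (Fin n))) : Prop where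
  subset_model : ∀ n, P n ⊆ undirModel d n
  iso_closed : ∀ n (G G' : SimpleGraph (Fin n)), Nonempty (G ≃g G') → G ∈ P n → G' ∈ P n

/-- The property is monotone (decreasing): it is preserved by the deletion of any edge. -/
def IsUndirMonotone (P : ∀ n : ℕ, Set (SimpleGraph (Fin n))) : Prop :=
  ∀ n, ∀ G ∈ P n, ∀ e ∈ G.edgeSet, G.deleteEdges {e} ∈ P n

/-- `P` is one-sided error strongly-testable in the undirected bounded-degree model. -/
def UndirStronglyTestable (d : ℕ) (P : ∀ n : ℕ, Set (SimpleGraph (Fin n))) : Prop :=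
  ∀ ε : ℝ, 0 < ε → ε < 1 → ∃ q : ℕ, ∀ n : ℕ,
    ∃ T : PMF (QueryAlg (Fin n) (Set (Fin n))),
      IsOneSidedTest undirOracle (undirModel d n) (P n)
        {G | ¬ CloseTo undirDist d n ε G (P n)} q T

/-- Each member of `𝓗` has at most `r` vertices. -/
def IsUndirRSet (r : ℕ) (𝓗 : Set (Σ k : ℕ, SimpleGraph (Fin k))) : Prop :=
  ∀ H ∈ 𝓗, H.1 ≤ r

/-- The `n`-vertex graphs of degree at most `d` that are `𝓗`-free (as subgraphs). -/
def undirFree (d : ℕ) (𝓗 : Set (Σ k : ℕ, SimpleGraph (Fin k))) (n : ℕ) :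
    Set (SimpleGraph (Fin n)) :=
  {G | G ∈ undirModel d n ∧ ∀ H ∈ 𝓗, ¬ SimpleGraph.IsContained H.2 G}

end FBTesting

namespace FBTesting

/-! ### Relations, balls and embeddings -/

/-! Both parts rest on facts about a binary relation `R` of bounded symmetrized degree; digraphs and
undirected graphs are two instances.

Testable implies `r`-sets. Let `𝓗` consist of all graphs of bounded size that no member of `P n`
contains. Suppose that `G` is `𝓗`-free but far. Some deterministic algorithm in the support of the
test rejects `G` after querying a set `S` of at most `q` vertices. The graph formed by the edges at
`S` gives the same answers, so one-sidedness puts it outside `P n`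
(`IsOneSidedTest.exists_view_notMem`). Its edges live on a bounded number of vertices
(`exists_embedding_range_supports`). That small graph embeds in `G`, hence is not in `𝓗`, hence
embeds in some member of `P n`. Extending the embedding to a permutation of the vertices
(`exists_perm_of_relEmb`) and using monotonicity puts the graph of edges at `S` back into `P n`, a
contradiction.

`r`-sets imply testable. Sample boundedly many `r`-tuples of vertices, explore the `r`-balls about
them, and accept iff the edges seen form a member of `P n`. Monotonicity makes the error one-sided.
If `G` is far, isolating a set of few vertices cannot make it `𝓗`-free. Isolate the vertices whose
ball hosts a rare type of component, where a type is rare if it embeds near fewer than `δ * n`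
vertices. There are boundedly many types, so few vertices are isolated and a member `H` of `𝓗`
survives. Each nontrivial component of `H` then has an abundant type, so a positive proportion of
all `r`-tuples have disjoint balls that host the components of `H` one by one
(`exists_many_revealing_tuples`). Such a tuple reveals a copy of `H`, which no member of `P n`
contains. Boundedly many samples suffice. -/

/-- The relation `R` contains an injective homomorphic copy of `h`. -/
def RelEmb {V W : Type} (h : W → W → Prop) (R : V → V → Prop) : Prop :=
  ∃ φ : W → V, Function.Injective φ ∧ ∀ u v, h u v → R (φ u) (φ v)

/-- The pairs of `R` with at least one end in `S`. -/
def incident {V : Type} (R : V → V → Prop) (S : Set V) : V → V → Prop :=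
  fun u v => R u v ∧ (u ∈ S ∨ v ∈ S)

/-- The pairs of `R` with no end in `B`. -/
def avoid {V : Type} (R : V → V → Prop) (B : Set V) : V → V → Prop :=
  fun u v => R u v ∧ u ∉ B ∧ v ∉ B

/-- The symmetrization of `R`. -/
def Touch {V : Type} (R : V → V → Prop) : V → V → Prop := fun u v => R u v ∨ R v u

/-- The vertices that can be reached from `v` by at most `j` steps of `N`. -/
def ball {V : Type} (N : V → V → Prop) : ℕ → V → Set V
  | 0, v => {v}
  | j + 1, v => {y | ∃ z, (z = v ∨ N v z) ∧ y ∈ ball N j z}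

section Balls

variable {V : Type} {N : V → V → Prop}

theorem self_mem_ball (j : ℕ) (v : V) : v ∈ ball N j v := by
  induction j with
  | zero => rfl
  | succ j ih => exact ⟨v, Or.inl rfl, ih⟩

theorem ball_mono {i j : ℕ} (h : i ≤ j) (v : V) : ball N i v ⊆ ball N j v := by
  induction i generalizing j v with
  | zero =>
    rintro y rfl
    exact self_mem_ball _ _
  | succ i ih =>
    obtain ⟨j, rfl⟩ : ∃ j', j = j' + 1 := ⟨j - 1, by omega⟩
    rintro y ⟨z, hz, hy⟩
    exact ⟨z, hz, ih (by omega) z hy⟩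

theorem mem_ball_add {i j : ℕ} {u v w : V} (hv : v ∈ ball N i u) (hw : w ∈ ball N j v) :
    w ∈ ball N (i + j) u := by
  induction i generalizing u with
  | zero =>
    obtain rfl : v = u := hv
    simpa using hw
  | succ i ih =>
    obtain ⟨z, hz, hy⟩ := hv
    rw [show i + 1 + j = (i + j) + 1 by omega]
    exact ⟨z, hz, ih hy⟩

theorem mem_ball_comm (hN : ∀ u v, N u v → N v u) {j : ℕ} {u v : V} (h : v ∈ ball N j u) :
    u ∈ ball N j v := by
  induction j generalizing u with
  | zero => exact Eq.symm h
  | succ j ih =>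
    obtain ⟨z, hz, hy⟩ := h
    refine mem_ball_add (ih hy) (⟨u, ?_, rfl⟩ : u ∈ ball N 1 z)
    exact hz.imp Eq.symm (hN _ _)

theorem ncard_ball_le [Finite V] {D : ℕ} (hD : ∀ v, {u | N v u}.ncard ≤ D) (j : ℕ) (v : V) :
    (ball N j v).ncard ≤ (D + 1) ^ j := by
  classical
  have := Fintype.ofFinite V
  induction j generalizing v with
  | zero => simp [ball]
  | succ j ih =>
    set F : Finset V := insert v (Set.toFinite {u | N v u}).toFinset with hF
    have hFc : F.card ≤ D + 1 := by
      refine (Finset.card_insert_le _ _).trans ?_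
      rw [← Set.ncard_eq_toFinset_card]
      exact Nat.succ_le_succ (hD v)
    have hsub : ball N (j + 1) v = ⋃ z ∈ F, ball N j z := by
      ext y
      simp [ball, hF]
    rw [hsub]
    calc _ ≤ ∑ z ∈ F, (ball N j z).ncard := Finset.set_ncard_biUnion_le _ _
      _ ≤ ∑ z ∈ F, (D + 1) ^ j := Finset.sum_le_sum fun z _ => ih z
      _ = F.card * (D + 1) ^ j := by simp
      _ ≤ (D + 1) * (D + 1) ^ j := Nat.mul_le_mul_right _ hFc
      _ = _ := by ring

end Balls

theorem Touch.symm {V : Type} {R : V → V → Prop} (u v : V) (h : Touch R u v) : Touch R v u :=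
  Or.symm h

theorem RelEmb.mono {V W : Type} {h : W → W → Prop} {R R' : V → V → Prop}
    (hR : ∀ u v, R u v → R' u v) (H : RelEmb h R) : RelEmb h R' := by
  obtain ⟨φ, hφ, hh⟩ := H
  exact ⟨φ, hφ, fun u v huv => hR _ _ (hh u v huv)⟩

/-! ### Counting scattered tuples -/

/-- If each of the sets `U i` is large and every point excludes few others, there are many tuples
with `i`-th entry in `U i` in which no entry excludes a later one. -/
theorem card_scattered_tuples {V : Type} [Fintype V] [DecidableEq V] (F : V → Set V) (K : ℕ)
    (hF : ∀ v, (F v).ncard ≤ K) (a : ℝ) (ha : 0 ≤ a) (m : ℕ) (U : Fin m → Set V)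
    (hU : ∀ i, a + m * K ≤ (U i).ncard) :
    ∃ T : Finset (Fin m → V), a ^ m ≤ T.card ∧
      ∀ u ∈ T, (∀ i, u i ∈ U i) ∧ ∀ i j, i < j → u j ∉ F (u i) := by
  classical
  -- The lower bound `b` on the sets is kept fixed during the induction on `m`, since the
  -- requirement `a + m * K ≤ b` only weakens as `m` decreases.
  suffices H : ∀ b : ℝ, ∀ m : ℕ, ∀ U : Fin m → Set V, (∀ i, b ≤ (U i).ncard) → a + m * K ≤ b →
      ∃ T : Finset (Fin m → V), a ^ m ≤ T.card ∧
        ∀ u ∈ T, (∀ i, u i ∈ U i) ∧ ∀ i j, i < j → u j ∉ F (u i) from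
    H _ m U hU le_rfl
  clear hU U m
  intro b m
  induction m with
  | zero =>
    intro U _ _
    exact ⟨{fun i => i.elim0}, by simp, fun u _ => ⟨fun i => i.elim0, fun i => i.elim0⟩⟩
  | succ m ih =>
    intro U hU hb
    obtain ⟨T, hT, hT'⟩ := ih (fun i => U i.castSucc) (fun i => hU _) (by
      have : (0 : ℝ) ≤ K := Nat.cast_nonneg _
      push_cast at hb
      nlinarith)
    set E : (Fin m → V) → Finset V := fun u =>
      (Set.toFinite (U (Fin.last m) \ ⋃ i ∈ (Finset.univ : Finset (Fin m)), F (u i))).toFinset with hE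
    have hEc : ∀ u, a ≤ (E u).card := by
      intro u
      rw [hE, ← Set.ncard_eq_toFinset_card]
      -- The `m` earlier entries exclude at most `m * K` points, so at least `a` choices remain for
      -- the last one.
      have h1 := Set.le_ncard_sdiff (⋃ i ∈ (Finset.univ : Finset (Fin m)), F (u i)) (U (Fin.last m))
      have h2 : (⋃ i ∈ (Finset.univ : Finset (Fin m)), F (u i)).ncard ≤ m * K := by
        refine (Finset.set_ncard_biUnion_le _ _).trans ?_
        refine (Finset.sum_le_sum fun i _ => hF (u i)).trans ?_
        simp
      have h3 : (U (Fin.last m)).ncard ≤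
          (U (Fin.last m) \ ⋃ i ∈ (Finset.univ : Finset (Fin m)), F (u i)).ncard + m * K := by
        omega
      have h4 : ((U (Fin.last m)).ncard : ℝ) ≤
          (U (Fin.last m) \ ⋃ i ∈ (Finset.univ : Finset (Fin m)), F (u i)).ncard + m * K := by
        exact_mod_cast h3
      have h5 := hU (Fin.last m)
      have : (0 : ℝ) ≤ K := Nat.cast_nonneg _
      push_cast at hb
      nlinarith
    refine ⟨(T.sigma E).image (fun p => Fin.snoc p.1 p.2), ?_, ?_⟩
    · rw [Finset.card_image_of_injective, Finset.card_sigma]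
      · push_cast
        calc a ^ (m + 1) = a ^ m * a := pow_succ _ _
          _ ≤ T.card * a := mul_le_mul_of_nonneg_right hT ha
          _ = ∑ u ∈ T, a := by simp
          _ ≤ _ := Finset.sum_le_sum fun u _ => hEc u
      · rintro ⟨u, x⟩ ⟨u', x'⟩ h
        have := Fin.snoc_injective2 h
        simp_all
    · intro u hu
      obtain ⟨⟨w, x⟩, hp, rfl⟩ := Finset.mem_image.1 hu
      obtain ⟨hw, hx⟩ := Finset.mem_sigma.1 hp
      simp only [hE, Set.Finite.mem_toFinset, Set.mem_sdiff, Set.mem_iUnion, not_exists,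
        Finset.mem_univ] at hx
      obtain ⟨h1, h2⟩ := hT' w hw
      refine ⟨fun i => ?_, fun i j hij => ?_⟩
      · refine Fin.lastCases ?_ (fun i => ?_) i
        · simpa using hx.1
        · simpa using h1 i
      · induction j using Fin.lastCases with
        | last =>
          induction i using Fin.lastCases with
          | last => exact absurd hij (lt_irrefl _)
          | cast i => simpa using hx.2 i
        | cast j =>
          induction i using Fin.lastCases with
          | last => exact absurd hij (not_lt.2 (Fin.le_last _))
          | cast i => simpa using h2 i j (by simpa using hij)

/-! ### Local embeddings -/

/-- The part `A` of `h` embeds into the `r`-ball of `R` about `v`. -/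
def LocalEmb {V W : Type} (R : V → V → Prop) (r : ℕ) (A : Set W) (h : W → W → Prop) (v : V) :
    Prop :=
  ∃ ψ : W → V, Set.InjOn ψ A ∧ (∀ x ∈ A, ∀ y ∈ A, h x y → R (ψ x) (ψ y)) ∧
    ∀ x ∈ A, ψ x ∈ ball (Touch R) r v

/-- Covers the isolated vertices of `h` and the indices whose class is empty: they impose no
condition and hence are abundant automatically. -/
theorem localEmb_of_subsingleton {V W : Type} (R : V → V → Prop) (r : ℕ) {A : Set W}
    (hA : A.Subsingleton) {h : W → W → Prop} (hh : ∀ x, ¬ h x x) (v : V) : LocalEmb R r A h v := by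
  refine ⟨fun _ => v, hA.injOn _, fun x hx y hy hxy => ?_, fun x _ => self_mem_ball _ _⟩
  rw [hA hx hy] at hxy
  exact absurd hxy (hh y)

theorem map_mem_ball_of_walk {V W : Type} {R : V → V → Prop} {h : W → W → Prop} {φ : W → V}
    (hφ : ∀ u v, h u v → R (φ u) (φ v)) {x y : W} (p : (SimpleGraph.fromRel h).Walk x y) :
    φ y ∈ ball (Touch R) p.length (φ x) := by
  induction p with
  | nil => exact rfl
  | cons hadj p ih =>
    refine ⟨_, Or.inr ?_, ih⟩
    rw [SimpleGraph.fromRel_adj] at hadj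
    exact hadj.2.imp (hφ _ _) (hφ _ _)

/-- The vertices of `h` fall into classes, each with a representative, such that related vertices
lie in the same class, embeddings map a class into a ball about the image of its representative,
and the representative of a class with at least two elements is not isolated. -/
theorem exists_component_rep {k : ℕ} (h : Fin k → Fin k → Prop) :
    ∃ ρ : Fin k → Fin k, (∀ x y, h x y → ρ x = ρ y) ∧
      (∀ (V : Type) (R : V → V → Prop) (φ : Fin k → V), (∀ u v, h u v → R (φ u) (φ v)) →
        ∀ x, φ x ∈ ball (Touch R) k (φ (ρ x))) ∧
      ∀ x, x ≠ ρ x → ∃ y, Touch h (ρ x) y := by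
  classical
  let G := SimpleGraph.fromRel h
  let ρ : Fin k → Fin k := fun x => (G.connectedComponentMk x).out
  have hρ : ∀ x, G.Reachable (ρ x) x := fun x =>
    SimpleGraph.ConnectedComponent.exact (Quot.out_eq (G.connectedComponentMk x))
  refine ⟨ρ, fun x y hxy => ?_, fun V R φ hφ x => ?_, fun x hx => ?_⟩
  · by_cases hne : x = y
    · rw [hne]
    · have hadj : G.Adj x y := (SimpleGraph.fromRel_adj _ _ _).2 ⟨hne, Or.inl hxy⟩
      have : G.connectedComponentMk x = G.connectedComponentMk y :=
        SimpleGraph.ConnectedComponent.sound hadj.reachable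
      simp only [ρ, this]
  -- A path on `k` vertices has fewer than `k` edges, which bounds the radius by `k`.
  · obtain ⟨p, hp⟩ := (hρ x).exists_isPath
    have := hp.length_lt
    rw [Fintype.card_fin] at this
    exact ball_mono this.le _ (map_mem_ball_of_walk hφ p)
  · obtain ⟨p⟩ := hρ x
    generalize ρ x = z at p hx
    cases p with
    | nil => contradiction
    | cons hadj p => exact ⟨_, ((SimpleGraph.fromRel_adj _ _ _).1 hadj).2⟩

/-- Embeddings of the classes of a partition of `h` into pairwise disjoint balls combine to an
embedding of `h`. -/
theorem relEmb_incident_of_localEmb {V W ι : Type} {R : V → V → Prop} {h : W → W → Prop} {r : ℕ}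
    (c : W → ι) (hc : ∀ x y, h x y → c x = c y) (u : ι → V)
    (hu : ∀ i, LocalEmb R r {x | c x = i} h (u i))
    (hdisj : ∀ i j, i ≠ j → ∀ z ∈ ball (Touch R) r (u i), z ∉ ball (Touch R) r (u j)) :
    RelEmb h (incident R (⋃ i, ball (Touch R) r (u i))) := by
  choose ψ hinj hhom hball using hu
  refine ⟨fun x => ψ (c x) x, fun x y hxy => ?_, fun x y hxy => ⟨?_, Or.inl ?_⟩⟩
  · by_cases hcxy : c x = c y
    · refine hinj (c y) hcxy rfl ?_
      simpa only [hcxy] using hxy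
    · refine absurd (hball (c y) y rfl) (hdisj _ _ hcxy _ ?_)
      have hx := hball (c x) x rfl
      have : ψ (c x) x = ψ (c y) y := hxy
      rwa [this] at hx
  · have := hhom (c x) x rfl y (hc x y hxy).symm hxy
    simpa only [hc x y hxy] using this
  · exact Set.mem_iUnion.2 ⟨c x, hball (c x) x rfl⟩

/-- If `R` has bounded degree and no removal of the edges at few vertices makes it `𝓗`-free,
then the balls about a positive proportion of all tuples of vertices reveal a member of `𝓗`. -/
theorem exists_many_revealing_tuples (D r : ℕ) (η : ℝ) (hη : 0 < η) :
    ∃ p : ℝ, 0 < p ∧ ∃ n₀ : ℕ, ∀ n : ℕ, n₀ ≤ n → ∀ R : Fin n → Fin n → Prop,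
      (∀ v, {u | Touch R v u}.ncard ≤ D) →
      ∀ 𝓗 : Set (Σ k : ℕ, Fin k → Fin k → Prop), (∀ H ∈ 𝓗, H.1 ≤ r ∧ ∀ v, ¬ H.2 v v) →
      (∀ B : Set (Fin n), (B.ncard : ℝ) ≤ η * n → ∃ H ∈ 𝓗, RelEmb H.2 (avoid R B)) →
      ∃ T : Finset (Fin r → Fin n), p * (n : ℝ) ^ r ≤ T.card ∧
        ∀ u ∈ T, ∃ H ∈ 𝓗, RelEmb H.2 (incident R (⋃ i, ball (Touch R) r (u i))) := by
  classical
  -- The component types: a relation on at most `r` points together with one of its classes. Their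
  -- number `M` depends on `r` only.
  let I := Σ k : Fin (r + 1), Set (Fin k) × (Fin k → Fin k → Prop)
  have : Fintype I := Fintype.ofFinite I
  let M : ℕ := Fintype.card I
  have hM : 0 < M := Fintype.card_pos_iff.2 ⟨⟨0, ∅, fun _ _ => False⟩⟩
  have hM' : (1 : ℝ) ≤ M := by exact_mod_cast hM
  -- The rare types together cover at most `M * δ * n ≤ η * n` vertices; `δ ≤ 1` makes a type that
  -- fits at every vertex abundant.
  set δ : ℝ := min η 1 / M with hδ
  have hδ0 : 0 < δ := by positivity
  have hδ1 : δ ≤ 1 := (div_le_self (by positivity) hM').trans (min_le_right _ _)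
  have hMδ : M * δ ≤ η := by
    rw [hδ, mul_div_cancel₀ _ (by positivity)]
    exact min_le_left _ _
  -- Two `r`-balls meet only if their centres are within distance `r + r`, so each centre excludes
  -- at most `K` others.
  set K : ℕ := (D + 1) ^ (r + r) with hK
  refine ⟨(δ / 2) ^ r, by positivity, ⌈(r * K : ℝ) / (δ / 2)⌉₊, fun n hn R hD 𝓗 h𝓗 hfar => ?_⟩
  have hn' : (r * K : ℝ) ≤ δ / 2 * n := by
    have := Nat.ceil_le.1 hn
    rw [div_le_iff₀ (by positivity)] at this
    linarith
  let S : I → Set (Fin n) := fun c => {v | LocalEmb R r c.2.1 c.2.2 v}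
  let Rare : Finset I := Finset.univ.filter fun c => ((S c).ncard : ℝ) < δ * n
  have hB : ((⋃ c ∈ Rare, S c).ncard : ℝ) ≤ η * n := by
    calc ((⋃ c ∈ Rare, S c).ncard : ℝ) ≤ ∑ c ∈ Rare, ((S c).ncard : ℝ) := by
          exact_mod_cast Finset.set_ncard_biUnion_le _ _
      _ ≤ ∑ c ∈ Rare, δ * n := Finset.sum_le_sum fun c hc => (Finset.mem_filter.1 hc).2.le
      _ = Rare.card * (δ * n) := by simp
      _ ≤ M * (δ * n) := by
          gcongr
          exact Finset.card_le_univ _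
      _ = M * δ * n := by ring
      _ ≤ η * n := by gcongr
  obtain ⟨⟨k, h⟩, hH, φ, hφ, hφR⟩ := hfar _ hB
  obtain ⟨hkr, hirr⟩ := h𝓗 _ hH
  simp only at hkr hirr φ hφ hφR
  obtain ⟨ρ, hρ, hρball, hρiso⟩ := exists_component_rep h
  let c : Fin k → Fin r := fun x => Fin.castLE hkr (ρ x)
  let A : Fin r → Set (Fin k) := fun i => {x | c x = i}
  have habund : ∀ i, δ * n ≤ ({v | LocalEmb R r (A i) h v}.ncard : ℝ) := by
    intro i
    by_cases hA : (A i).Subsingleton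
    · have : {v | LocalEmb R r (A i) h v} = Set.univ :=
        Set.eq_univ_of_forall fun v => localEmb_of_subsingleton R r hA hirr v
      rw [this, Set.ncard_univ, Nat.card_eq_fintype_card, Fintype.card_fin]
      exact mul_le_of_le_one_left (Nat.cast_nonneg _) hδ1
    · obtain ⟨x, hx, hxρ⟩ : ∃ x ∈ A i, x ≠ ρ x := by
        by_contra! hcon
        refine hA fun x hx y hy => ?_
        rw [hcon x hx, hcon y hy]
        exact Fin.castLE_injective hkr (hx.trans hy.symm)
      have hloc : LocalEmb R r (A i) h (φ (ρ x)) := by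
        refine ⟨φ, hφ.injOn, fun x _ y _ hxy => (hφR x y hxy).1, fun y hy => ?_⟩
        have hxy : ρ y = ρ x := Fin.castLE_injective hkr (hy.trans hx.symm)
        rw [← hxy]
        exact ball_mono hkr _ (hρball _ R φ (fun u v huv => (hφR u v huv).1) y)
      by_contra hlt
      obtain ⟨y, hy⟩ := hρiso x hxρ
      -- The representative lies on an edge of `h`, whose image survives the isolation of the rare
      -- vertices.
      have hnot : φ (ρ x) ∉ ⋃ c ∈ Rare, S c := by
        rcases hy with hy | hy
        · exact (hφR _ _ hy).2.1
        · exact (hφR _ _ hy).2.2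
      refine hnot (Set.mem_biUnion (x := (⟨⟨k, by omega⟩, A i, h⟩ : I)) ?_ hloc)
      exact Finset.mem_filter.2 ⟨Finset.mem_univ _, not_le.1 hlt⟩
  obtain ⟨T, hT, hT'⟩ := card_scattered_tuples (ball (Touch R) (r + r)) K
    (fun v => ncard_ball_le hD _ v) (δ / 2 * n) (by positivity) r
    -- Half of the `δ * n` candidates pays for the excluded points, by the choice of `n₀`; the other
    -- half gives the count.
    (fun i => {v | LocalEmb R r (A i) h v}) (fun i => by linarith [habund i])
  refine ⟨T, by rwa [← mul_pow], fun u hu => ⟨⟨k, h⟩, hH, ?_⟩⟩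
  obtain ⟨hu1, hu2⟩ := hT' u hu
  have hmeet : ∀ i j, ∀ z ∈ ball (Touch R) r (u i), z ∈ ball (Touch R) r (u j) →
      u j ∈ ball (Touch R) (r + r) (u i) := fun i j z hi hj =>
    mem_ball_add hi (mem_ball_comm Touch.symm hj)
  refine relEmb_incident_of_localEmb c (fun x y hxy => by simp only [c, hρ x y hxy]) u hu1
    fun i j hij z hi hj => ?_
  rcases lt_or_gt_of_ne hij with hlt | hlt
  · exact hu2 i j hlt (hmeet i j z hi hj)
  · exact hu2 j i hlt (hmeet j i z hj hi)

/-! ### Exploring balls by queries -/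

namespace QueryAlg

variable {V A : Type}

/-- Query all vertices of a list and continue with the list of answers. -/
def queryList : List V → (List (V × A) → QueryAlg V A) → QueryAlg V A
  | [], next => next []
  | v :: l, next => query v fun a => queryList l fun ans => next ((v, a) :: ans)

theorem run_queryList (o : V → A) (l : List V) (next : List (V × A) → QueryAlg V A) :
    (queryList l next).run o = (next (l.map fun v => (v, o v))).run o := by
  induction l generalizing next with
  | nil => rfl
  | cons v l ih => simp [queryList, run, ih]

theorem cost_queryList (o : V → A) (l : List V) (next : List (V × A) → QueryAlg V A) :
    (queryList l next).cost o = (next (l.map fun v => (v, o v))).cost o + l.length := by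
  induction l generalizing next with
  | nil => rfl
  | cons v l ih =>
    simp only [queryList, cost, ih, List.map_cons, List.length_cons]
    omega

/-- Explore the `j`-balls about the vertices of a list, where `nb` extracts the neighbours from an
answer, and halt with a verdict that depends on all the answers. -/
def explore (nb : A → List V) : ℕ → List V → (List (V × A) → Bool) → QueryAlg V A
  | 0, l, dec => queryList l fun ans => halt (dec ans)
  | j + 1, l, dec => queryList l fun ans => explore nb j (l ++ ans.flatMap fun p => nb p.2) dec

/-- The list of vertices visited when exploring the `j`-balls about the vertices of a list. -/
def ballList (nb : V → List V) : ℕ → List V → List V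
  | 0, l => l
  | j + 1, l => ballList nb j (l ++ l.flatMap nb)

theorem run_explore (o : V → A) (nb : A → List V) (j : ℕ) (l : List V)
    (dec : List (V × A) → Bool) :
    (explore nb j l dec).run o =
      dec ((ballList (fun v => nb (o v)) j l).map fun v => (v, o v)) := by
  induction j generalizing l with
  | zero => simp [explore, ballList, run_queryList, run]
  | succ j ih => simp [explore, ballList, run_queryList, ih, List.flatMap_map]

theorem length_append_flatMap_le {nb : V → List V} {D : ℕ} (hD : ∀ v, (nb v).length ≤ D)
    (l : List V) : (l ++ l.flatMap nb).length ≤ (D + 1) * l.length := by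
  induction l with
  | nil => simp
  | cons v l ih =>
    have := hD v
    simp only [List.flatMap_cons, List.length_append, List.length_cons] at ih ⊢
    linarith

/-- Each of the `j + 1` rounds queries its whole list again, and the list grows by a factor of at
most `D + 1` between rounds. -/
theorem cost_explore_le (o : V → A) (nb : A → List V) {D : ℕ} (hD : ∀ v, (nb (o v)).length ≤ D)
    (j : ℕ) (l : List V) (dec : List (V × A) → Bool) :
    (explore nb j l dec).cost o ≤ (j + 1) * (D + 1) ^ j * l.length := by
  induction j generalizing l with
  | zero => simp [explore, cost_queryList, cost]
  | succ j ih =>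
    rw [explore, cost_queryList, List.flatMap_map]
    have h1 := ih (l ++ l.flatMap fun v => nb (o v))
    have h2 := length_append_flatMap_le hD l
    have h3 : (j + 1) * (D + 1) ^ j * (l ++ l.flatMap fun v => nb (o v)).length ≤
        (j + 1) * (D + 1) ^ j * ((D + 1) * l.length) := Nat.mul_le_mul_left _ h2
    have h4 : l.length ≤ (D + 1) ^ (j + 1) * l.length :=
      Nat.le_mul_of_pos_left _ (by positivity)
    calc _ ≤ (j + 1) * (D + 1) ^ j * ((D + 1) * l.length) + (D + 1) ^ (j + 1) * l.length :=
          Nat.add_le_add (h1.trans h3) h4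
      _ = _ := by ring

theorem mem_ballList {nb : V → List V} {N : V → V → Prop} (h : ∀ u v, v ∈ nb u ↔ N u v) (j : ℕ)
    (l : List V) (x : V) : x ∈ ballList nb j l ↔ ∃ v ∈ l, x ∈ ball N j v := by
  induction j generalizing l with
  | zero => simp [ballList, ball]
  | succ j ih =>
    simp only [ballList, ih, List.mem_append, List.mem_flatMap, ball, Set.mem_ofPred_eq, h]
    constructor
    · rintro ⟨v, hv | ⟨w, hw, hwv⟩, hx⟩
      · exact ⟨v, hv, v, Or.inl rfl, hx⟩
      · exact ⟨w, hw, v, Or.inr hwv, hx⟩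
    · rintro ⟨v, hv, z, rfl | hz, hx⟩
      · exact ⟨z, Or.inl hv, hx⟩
      · exact ⟨z, Or.inr ⟨v, hv, hz⟩, hx⟩

end QueryAlg

/-! ### Uniform distributions over algorithms -/

theorem isOneSidedTest_uniform {V A X Ω : Type} [Fintype Ω] [Nonempty Ω] {oracle : X → V → A}
    {model yes far : Set X} {q : ℕ} (alg : Ω → QueryAlg V A)
    (hcost : ∀ G ∈ model, ∀ ω, (alg ω).cost (oracle G) ≤ q)
    (hyes : ∀ G ∈ yes, ∀ ω, (alg ω).run (oracle G) = true)
    (hfar : ∀ G ∈ model, G ∈ far →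
      Nat.card Ω ≤ 2 * {ω | (alg ω).run (oracle G) = false}.ncard) :
    IsOneSidedTest oracle model yes far q ((PMF.uniformOfFintype Ω).map alg) where
  query_le := by
    intro G hG t ht
    obtain ⟨ω, _, rfl⟩ := (PMF.mem_support_map_iff _ _ _).1 ht
    exact hcost G hG ω
  accepts := by
    intro G _ hG
    rw [PMF.map_comp, PMF.apply_eq_one_iff, PMF.support_map, PMF.support_uniformOfFintype]
    ext b
    simp only [Set.mem_image, Function.comp_apply, hyes G hG, Set.mem_singleton_iff]
    constructor
    · rintro ⟨_, _, rfl⟩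
      rfl
    · rintro rfl
      exact ⟨Classical.arbitrary Ω, trivial, rfl⟩
  rejects := by
    classical
    intro G hG hGf
    have h := hfar G hG hGf
    rw [PMF.map_comp, ← PMF.toOuterMeasure_apply_singleton, PMF.toOuterMeasure_map_apply,
      PMF.toOuterMeasure_uniformOfFintype_apply]
    have hs : Fintype.card ↑(((fun t => t.run (oracle G)) ∘ alg) ⁻¹' {false}) =
        {ω | (alg ω).run (oracle G) = false}.ncard := by
      rw [← Nat.card_eq_fintype_card, Nat.card_coe_set_eq]
      rfl
    rw [hs]
    rw [Nat.card_eq_fintype_card] at h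
    have hpos : (Fintype.card Ω : ENNReal) ≠ 0 := by simp
    rw [ENNReal.le_div_iff_mul_le (Or.inl hpos) (Or.inl (by simp)), mul_comm, ← div_eq_mul_one_div]
    refine ENNReal.div_le_of_le_mul' ?_
    exact_mod_cast h

/-- Every algorithm in the support of a one-sided error test accepts every yes-instance. -/
theorem IsOneSidedTest.run_eq_true {V A X : Type} {oracle : X → V → A} {model yes far : Set X}
    {q : ℕ} {T : PMF (QueryAlg V A)} (hT : IsOneSidedTest oracle model yes far q T) {G : X}
    (hG : G ∈ model) (hy : G ∈ yes) {t : QueryAlg V A} (ht : t ∈ T.support) :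
    t.run (oracle G) = true := by
  have h := (PMF.apply_eq_one_iff _ _).1 (hT.accepts G hG hy)
  have : t.run (oracle G) ∈ (T.map fun t => t.run (oracle G)).support :=
    (PMF.mem_support_map_iff _ _ _).2 ⟨t, ht, rfl⟩
  rwa [h] at this

/-- Every far instance is rejected by some algorithm in the support of the test. -/
theorem IsOneSidedTest.exists_run_eq_false {V A X : Type} {oracle : X → V → A}
    {model yes far : Set X} {q : ℕ} {T : PMF (QueryAlg V A)}
    (hT : IsOneSidedTest oracle model yes far q T) {G : X} (hG : G ∈ model) (hf : G ∈ far) :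
    ∃ t ∈ T.support, t.run (oracle G) = false := by
  refine (PMF.mem_support_map_iff _ _ _).1 ((PMF.mem_support_iff _ _).2 fun h => ?_)
  have := hT.rejects G hG hf
  rw [h] at this
  simp at this

/-! ### The test -/

/-- Independent repetition in counting form: all `N` samples miss `T` for a proportion of at most
`(1 - p) ^ N` of the outcomes. -/
theorem two_mul_ncard_exists_ge {Ω : Type} [Fintype Ω] (T : Set Ω) (p : ℝ) (N : ℕ)
    (hp : (1 - p) ^ N ≤ 1 / 2) (hT : p * Nat.card Ω ≤ T.ncard) :
    Nat.card (Fin N → Ω) ≤ 2 * {ω : Fin N → Ω | ∃ i, ω i ∈ T}.ncard := by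
  classical
  have hcompl : {ω : Fin N → Ω | ∃ i, ω i ∈ T}ᶜ = Set.pi Set.univ fun _ => Tᶜ := by
    ext ω
    simp
  have h1 := Set.ncard_add_ncard_compl {ω : Fin N → Ω | ∃ i, ω i ∈ T}
  have h2 : ({ω : Fin N → Ω | ∃ i, ω i ∈ T}ᶜ).ncard = Tᶜ.ncard ^ N := by
    rw [hcompl, ← Nat.card_coe_set_eq, Nat.card_congr (Equiv.Set.univPi _), Nat.card_pi]
    simp only [Nat.card_coe_set_eq, Finset.prod_const, Finset.card_univ, Fintype.card_fin]
  have h3 := Set.ncard_add_ncard_compl T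
  have h4 : Nat.card (Fin N → Ω) = Nat.card Ω ^ N := by simp
  have h5 : (Tᶜ.ncard : ℝ) ≤ (1 - p) * Nat.card Ω := by
    have : (T.ncard : ℝ) + Tᶜ.ncard = Nat.card Ω := by exact_mod_cast h3
    linarith
  have h6 : (Tᶜ.ncard : ℝ) ^ N ≤ 1 / 2 * (Nat.card Ω : ℝ) ^ N := by
    calc (Tᶜ.ncard : ℝ) ^ N ≤ ((1 - p) * Nat.card Ω) ^ N := by gcongr
      _ = (1 - p) ^ N * (Nat.card Ω : ℝ) ^ N := mul_pow _ _ _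
      _ ≤ _ := by gcongr
  have h7 : 2 * Tᶜ.ncard ^ N ≤ Nat.card Ω ^ N := by
    have : (2 : ℝ) * (Tᶜ.ncard : ℝ) ^ N ≤ (Nat.card Ω : ℝ) ^ N := by linarith
    exact_mod_cast this
  rw [h2] at h1
  omega

/-- The abstract tester: in a model of bounded degree with neighbourhood queries, a property that
survives the restriction of its members to the edges at a vertex set, whose members are `𝓗`-free,
and from whose far inputs `𝓗` cannot be removed by isolating few vertices, has a one-sided error
test with a number of queries independent of `n`. -/
theorem exists_isOneSidedTest (D r : ℕ) (η : ℝ) (hη : 0 < η) :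
    ∃ q : ℕ, ∀ (n : ℕ) (A X : Type) (oracle : X → Fin n → A) (adj : X → Fin n → Fin n → Prop)
      (nb : A → Set (Fin n)) (view : X → Set (Fin n) → X) (model yes far : Set X)
      (𝓗 : Set (Σ k : ℕ, Fin k → Fin k → Prop)),
      (∀ G v, nb (oracle G v) = {u | Touch (adj G) v u}) →
      (∀ G ∈ model, ∀ v, {u | Touch (adj G) v u}.ncard ≤ D) →
      (∀ G S, adj (view G S) = incident (adj G) S) →
      (∀ G G' S, (∀ v ∈ S, oracle G v = oracle G' v) → view G S = view G' S) →
      (∀ G, view G Set.univ = G) →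
      (∀ G ∈ yes, ∀ S, view G S ∈ yes) →
      (∀ H ∈ 𝓗, H.1 ≤ r ∧ ∀ v, ¬ H.2 v v) →
      (∀ G ∈ yes, ∀ H ∈ 𝓗, ¬ RelEmb H.2 (adj G)) →
      (∀ G ∈ model, G ∈ far → G ∉ yes ∧ ∀ B : Set (Fin n), (B.ncard : ℝ) ≤ η * n →
        ∃ H ∈ 𝓗, RelEmb H.2 (avoid (adj G) B)) →
      ∃ T : PMF (QueryAlg (Fin n) A), IsOneSidedTest oracle model yes far q T := by
  classical
  obtain ⟨p, hp, n₀, hmany⟩ := exists_many_revealing_tuples D r η hη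
  set p' := min p 1 with hp'
  have hp'0 : 0 < p' := by positivity
  obtain ⟨N, hN⟩ := exists_pow_lt_of_lt_one (show (0 : ℝ) < 1 / 2 by norm_num)
    (show 1 - p' < 1 by linarith)
  refine ⟨(r + 1) * (D + 1) ^ r * (N * r) + n₀, ?_⟩
  intro n A X oracle adj nb view model yes far 𝓗 hnb hD hadj hloc huniv hyes h𝓗 hfree hfar
  -- Only the answers are known, so the verdict quantifies over the inputs consistent with them. All
  -- of these have the same view, so for the answers of `G` the verdict says whether the view of `G`
  -- lies in `yes`.
  let dec : List (Fin n × A) → Bool := fun ans =>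
    decide (∃ G, (∀ x ∈ ans, oracle G x.1 = x.2) ∧ view G {v | ∃ x ∈ ans, x.1 = v} ∈ yes)
  have hdec : ∀ G (l : List (Fin n)), dec (l.map fun v => (v, oracle G v)) =
      decide (view G {v | v ∈ l} ∈ yes) := by
    intro G l
    refine decide_eq_decide.2 ⟨?_, fun h => ⟨G, by simp, by simpa using h⟩⟩
    rintro ⟨G', h1, h2⟩
    have hS : {v | ∃ x ∈ l.map fun v => (v, oracle G v), x.1 = v} = {v | v ∈ l} := by simp
    rw [hS] at h2
    rwa [hloc G G' {v | v ∈ l} fun v hv => (h1 (v, oracle G v) (List.mem_map_of_mem hv)).symm]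
  let nbl : A → List (Fin n) := fun a => (Set.toFinite (nb a)).toFinset.toList
  have hnbl : ∀ G u v, v ∈ nbl (oracle G u) ↔ Touch (adj G) u v := by
    intro G u v
    simp [nbl, hnb]
  have hlen : ∀ G ∈ model, ∀ v, (nbl (oracle G v)).length ≤ D := by
    intro G hG v
    rw [Finset.length_toList, ← Set.ncard_eq_toFinset_card, hnb]
    exact hD G hG v
  -- Positivity of `n` keeps the sample space nonempty. In the other case `n ≤ n₀`, and all vertices
  -- are queried.
  by_cases hn : n₀ ≤ n ∧ 0 < n
  · have : Nonempty (Fin n) := ⟨⟨0, hn.2⟩⟩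
    let L : (Fin N → Fin r → Fin n) → List (Fin n) := fun ω =>
      (List.finRange N).flatMap fun i => (List.finRange r).map fun j => ω i j
    have hL : ∀ ω, (L ω).length = N * r := by
      intro ω
      simp [L]
    refine ⟨_, isOneSidedTest_uniform (fun ω => QueryAlg.explore nbl r (L ω) dec) ?_ ?_ ?_⟩
    · intro G hG ω
      refine (QueryAlg.cost_explore_le _ _ (hlen G hG) _ _ _).trans ?_
      rw [hL]
      exact Nat.le_add_right _ _
    · intro G hG ω
      rw [QueryAlg.run_explore, hdec]
      exact decide_eq_true (hyes G hG _)
    · intro G hG hGf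
      obtain ⟨T, hT, hrev⟩ := hmany n hn.1 (adj G) (hD G hG) 𝓗 h𝓗 (hfar G hG hGf).2
      refine (two_mul_ncard_exists_ge (T : Set (Fin r → Fin n)) p' N hN.le
        ?_).trans (Nat.mul_le_mul_left 2 (Set.ncard_le_ncard ?_))
      · rw [Set.ncard_coe_finset]
        refine le_trans ?_ hT
        rw [Nat.card_fun]
        simp only [Nat.card_eq_fintype_card, Fintype.card_fin, Nat.cast_pow]
        gcongr
        exact min_le_left _ _
      · rintro ω ⟨i, hi⟩
        obtain ⟨H, hH, hemb⟩ := hrev (ω i) hi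
        change QueryAlg.run _ _ = false
        rw [QueryAlg.run_explore, hdec]
        refine decide_eq_false fun hy => hfree _ hy H hH ?_
        rw [hadj]
        refine hemb.mono fun u v huv => ?_
        have hsub : ∀ x ∈ ⋃ j, ball (Touch (adj G)) r (ω i j),
            x ∈ QueryAlg.ballList (fun v => nbl (oracle G v)) r (L ω) := by
          intro x hx
          obtain ⟨j, hj⟩ := Set.mem_iUnion.1 hx
          rw [QueryAlg.mem_ballList (hnbl G)]
          refine ⟨ω i j, ?_, hj⟩
          simp [L]
        exact ⟨huv.1, huv.2.imp (hsub _) (hsub _)⟩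
  · have hn' : n ≤ n₀ := by omega
    have hS : {v : Fin n | v ∈ List.finRange n} = Set.univ := by simp
    refine ⟨_, isOneSidedTest_uniform
      (fun _ : Unit => QueryAlg.explore nbl 0 (List.finRange n) dec) ?_ ?_ ?_⟩
    · intro G hG ω
      refine (QueryAlg.cost_explore_le _ _ (hlen G hG) _ _ _).trans ?_
      simp only [List.length_finRange, pow_zero, zero_add, one_mul]
      omega
    · intro G hG ω
      rw [QueryAlg.run_explore, hdec]
      exact decide_eq_true (hyes G hG _)
    · intro G hG hGf
      have : {ω : Unit | (QueryAlg.explore nbl 0 (List.finRange n) dec).run (oracle G) = false} =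
          Set.univ := by
        refine Set.eq_univ_of_forall fun ω => ?_
        change QueryAlg.run _ _ = false
        rw [QueryAlg.run_explore, hdec]
        refine decide_eq_false fun hy => (hfar G hG hGf).1 ?_
        rwa [QueryAlg.ballList, hS, huniv] at hy
      rw [this, Set.ncard_univ]
      omega

/-! ### Obstructions from rejecting runs -/

namespace QueryAlg

/-- The vertices queried in the run in which queries are answered by `o`. -/
def queried {V A : Type} (o : V → A) : QueryAlg V A → List V
  | halt _ => []
  | query v next => v :: queried o (next (o v))

theorem length_queried {V A : Type} (o : V → A) (t : QueryAlg V A) :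
    (t.queried o).length = t.cost o := by
  induction t with
  | halt b => rfl
  | query v next ih => simp [queried, cost, ih]

/-- A run depends on the oracle only at the vertices it queries. -/
theorem run_congr {V A : Type} {o o' : V → A} (t : QueryAlg V A)
    (h : ∀ v ∈ t.queried o, o' v = o v) : t.run o' = t.run o := by
  induction t with
  | halt b => rfl
  | query v next ih =>
    have hv : o' v = o v := h v (by simp [queried])
    rw [run, run, hv]
    exact ih _ fun w hw => h w (by simp [queried, hw])

end QueryAlg

/-- A far input contains few vertices such that the edges at them do not form a yes-instance. -/
theorem IsOneSidedTest.exists_view_notMem {V A X : Type} {oracle : X → V → A}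
    {model yes far : Set X} {q : ℕ} {T : PMF (QueryAlg V A)}
    (hT : IsOneSidedTest oracle model yes far q T) {view : X → Set V → X}
    (hview : ∀ G S, ∀ v ∈ S, oracle (view G S) v = oracle G v) (hsub : yes ⊆ model) {G : X}
    (hG : G ∈ model) (hf : G ∈ far) : ∃ S : Set V, S.ncard ≤ q ∧ view G S ∉ yes := by
  classical
  obtain ⟨t, ht, hrun⟩ := hT.exists_run_eq_false hG hf
  refine ⟨{v | v ∈ t.queried (oracle G)}, ?_, fun hy => ?_⟩
  · have : {v | v ∈ t.queried (oracle G)} = ((t.queried (oracle G)).toFinset : Set V) := by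
      ext
      simp
    rw [this, Set.ncard_coe_finset]
    refine (List.toFinset_card_le _).trans ?_
    rw [QueryAlg.length_queried]
    exact hT.query_le G hG t ht
  · have := hT.run_eq_true (hsub hy) hy ht
    exact Bool.false_ne_true (hrun.symm.trans ((t.run_congr (hview G _)).symm.trans this))

/-- The edges at a small vertex set live on a small vertex set. -/
theorem exists_embedding_range_supports {n D : ℕ} {R : Fin n → Fin n → Prop}
    (hD : ∀ v, {u | Touch R v u}.ncard ≤ D) (S : Set (Fin n)) :
    ∃ k ≤ S.ncard * (D + 1), ∃ e : Fin k → Fin n, Function.Injective e ∧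
      ∀ u v, incident R S u v → u ∈ Set.range e ∧ v ∈ Set.range e := by
  classical
  let W : Finset (Fin n) := (Set.toFinite S).toFinset.biUnion fun v =>
    (Set.toFinite (ball (Touch R) 1 v)).toFinset
  have hW : W.card ≤ S.ncard * (D + 1) := by
    rw [Set.ncard_eq_toFinset_card S]
    refine Finset.card_biUnion_le_card_mul _ _ _ fun v _ => ?_
    rw [← Set.ncard_eq_toFinset_card]
    simpa using ncard_ball_le hD 1 v
  have hmem : ∀ s ∈ S, ∀ x, (x = s ∨ Touch R s x) → x ∈ W := by
    intro s hs x hx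
    refine Finset.mem_biUnion.2 ⟨s, by simpa using hs, ?_⟩
    rw [Set.Finite.mem_toFinset]
    exact ⟨x, hx, rfl⟩
  refine ⟨W.card, hW, fun i => W.equivFin.symm i,
    Subtype.val_injective.comp W.equivFin.symm.injective, ?_⟩
  have hrange : ∀ x ∈ W, x ∈ Set.range fun i => (W.equivFin.symm i : Fin n) :=
    fun x hx => ⟨W.equivFin ⟨x, hx⟩, by simp⟩
  rintro u v ⟨huv, hu | hv⟩
  · exact ⟨hrange _ (hmem u hu u (Or.inl rfl)), hrange _ (hmem u hu v (Or.inr (Or.inl huv)))⟩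
  · exact ⟨hrange _ (hmem v hv u (Or.inr (Or.inr huv))), hrange _ (hmem v hv v (Or.inl rfl))⟩

/-- An embedding of the support of `Q` extends to a permutation of the vertices. -/
theorem exists_perm_of_relEmb {V W : Type} [Finite V] {Q R : V → V → Prop} {e : W → V}
    (he : Function.Injective e) (hQ : ∀ u v, Q u v → u ∈ Set.range e ∧ v ∈ Set.range e)
    (h : RelEmb (fun a b => Q (e a) (e b)) R) :
    ∃ σ : Equiv.Perm V, ∀ u v, Q u v → R (σ u) (σ v) := by
  classical
  obtain ⟨φ, hφ, hR⟩ := h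
  let E : {x // x ∈ Set.range e} ≃ {x // x ∈ Set.range φ} :=
    (Equiv.ofInjective e he).symm.trans (Equiv.ofInjective φ hφ)
  have hE : ∀ a, E.extendSubtype (e a) = φ a := by
    intro a
    rw [Equiv.extendSubtype_apply_of_mem _ _ (Set.mem_range_self a)]
    simp [E, Equiv.ofInjective_symm_apply]
  refine ⟨E.extendSubtype, fun u v huv => ?_⟩
  obtain ⟨⟨a, rfl⟩, ⟨b, rfl⟩⟩ := hQ u v huv
  rw [hE, hE]
  exact hR a b huv

theorem CloseTo.mono {X : Type} {dist : X → X → ℕ} {d n : ℕ} {ε ε' : ℝ} {G : X} {S : Set X}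
    (h : CloseTo dist d n ε G S) (hε : ε ≤ ε') : CloseTo dist d n ε' G S := by
  obtain ⟨G', hG', hd⟩ := h
  refine ⟨G', hG', hd.trans ?_⟩
  gcongr

theorem closeTo_of_mem {X : Type} {dist : X → X → ℕ} {d n : ℕ} {ε : ℝ} (hε : 0 ≤ ε) {G : X}
    {S : Set X} (hG : G ∈ S) (hdist : dist G G = 0) : CloseTo dist d n ε G S :=
  ⟨G, hG, by rw [hdist, Nat.cast_zero]; positivity⟩

theorem CloseTo.of_dist_le {X : Type} {dist : X → X → ℕ} {d n : ℕ} {ε ε' : ℝ} {G G' : X}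
    {S : Set X} (htri : ∀ a b c, dist a c ≤ dist a b + dist b c)
    (hd : (dist G G' : ℝ) ≤ ε * d * n) (h : CloseTo dist d n ε' G' S) :
    CloseTo dist d n (ε + ε') G S := by
  obtain ⟨G'', hG'', hd'⟩ := h
  refine ⟨G'', hG'', ?_⟩
  have : (dist G G'' : ℝ) ≤ dist G G' + dist G' G'' := by exact_mod_cast htri G G' G''
  linarith

theorem ncard_symmDiff_triangle {α : Type} [Finite α] (s t u : Set α) :
    (symmDiff s u).ncard ≤ (symmDiff s t).ncard + (symmDiff t u).ncard :=
  (Set.ncard_le_ncard (symmDiff_triangle s t u)).trans (Set.ncard_union_le _ _)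

/-! ### Digraphs -/

/-- The spanning subdigraph of the arcs with an end in `S`. -/
def diView {V : Type} (G : Digraph V) (S : Set V) : Digraph V := ⟨incident G.Adj S⟩

theorem fbOracle_diView {n : ℕ} (G : Digraph (Fin n)) (S : Set (Fin n)) :
    ∀ v ∈ S, fbOracle (diView G S) v = fbOracle G v := by
  intro v hv
  refine Prod.ext (Set.ext fun u => ?_) (Set.ext fun u => ?_)
  · exact and_iff_left (Or.inl hv)
  · exact and_iff_left (Or.inr hv)

theorem diView_congr {n : ℕ} (G G' : Digraph (Fin n)) (S : Set (Fin n))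
    (h : ∀ v ∈ S, fbOracle G v = fbOracle G' v) : diView G S = diView G' S := by
  have h1 : ∀ v ∈ S, ∀ u, (G.Adj v u ↔ G'.Adj v u) ∧ (G.Adj u v ↔ G'.Adj u v) := fun v hv u =>
    ⟨Set.ext_iff.1 (congrArg Prod.fst (h v hv)) u, Set.ext_iff.1 (congrArg Prod.snd (h v hv)) u⟩
  refine Digraph.ext (funext₂ fun u v => propext ?_)
  refine and_congr_left fun huv => ?_
  rcases huv with hu | hv
  · exact (h1 u hu v).1
  · exact (h1 v hv u).2

theorem ncard_touch_le_of_mem_fbModel {d n : ℕ} {G : Digraph (Fin n)} (hG : G ∈ fbModel d n)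
    (v : Fin n) : {u | Touch G.Adj v u}.ncard ≤ 2 * d := by
  have : {u | Touch G.Adj v u} = outNbrs G v ∪ inNbrs G v := rfl
  rw [this]
  have := Set.ncard_union_le (outNbrs G v) (inNbrs G v)
  have := hG.2 v
  omega

theorem fbModel_of_le {d n : ℕ} {G G' : Digraph (Fin n)} (hG : G ∈ fbModel d n)
    (h : ∀ u v, G'.Adj u v → G.Adj u v) : G' ∈ fbModel d n :=
  ⟨fun v hv => hG.1 v (h _ _ hv), fun v =>
    ⟨(Set.ncard_le_ncard fun _ hu => h _ _ hu).trans (hG.2 v).1,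
      (Set.ncard_le_ncard fun _ hu => h _ _ hu).trans (hG.2 v).2⟩⟩

theorem IsDiMonotone.of_le {P : ∀ n : ℕ, Set (Digraph (Fin n))} (hP : IsDiMonotone P) {n : ℕ}
    {G G' : Digraph (Fin n)} (hG : G ∈ P n) (h : ∀ u v, G'.Adj u v → G.Adj u v) : G' ∈ P n := by
  induction hm : (arcSet G \ arcSet G').ncard using Nat.strong_induction_on generalizing G with
  | _ m ih =>
    by_cases hle : ∀ u v, G.Adj u v → G'.Adj u v
    · rwa [Digraph.ext (funext₂ fun u v => propext ⟨h u v, hle u v⟩) (y := G)]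
    · push Not at hle
      obtain ⟨u, v, huv, huv'⟩ := hle
      refine ih _ ?_ (hP n G hG u v huv) (fun a b hab => ⟨h a b hab, ?_⟩) rfl
      · rw [← hm]
        refine Set.ncard_lt_ncard ⟨fun e he => ⟨he.1.1, he.2⟩, fun hsub => ?_⟩
        exact (hsub (show (u, v) ∈ arcSet G \ arcSet G' from ⟨huv, huv'⟩)).1.2 ⟨rfl, rfl⟩
      · rintro ⟨rfl, rfl⟩
        exact huv' hab

theorem IsDiMonotone.of_perm {d : ℕ} {P : ∀ n : ℕ, Set (Digraph (Fin n))}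
    (hP : IsDiMonotone P) (hPd : IsDiProperty d P) {n : ℕ} {G G' : Digraph (Fin n)} (hG : G ∈ P n)
    (σ : Equiv.Perm (Fin n)) (h : ∀ u v, G'.Adj u v → G.Adj (σ u) (σ v)) : G' ∈ P n := by
  refine hP.of_le (hPd.iso_closed n G ⟨fun u v => G.Adj (σ u) (σ v)⟩ ⟨σ.symm, fun u v => ?_⟩ hG) h
  simp

theorem diDist_self {V : Type} (G : Digraph V) : diDist G G = 0 := by simp [diDist]

theorem diDist_triangle {n : ℕ} (G G' G'' : Digraph (Fin n)) :
    diDist G G'' ≤ diDist G G' + diDist G' G'' := ncard_symmDiff_triangle _ _ _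

theorem diDist_avoid_le {d n : ℕ} {G : Digraph (Fin n)} (hG : G ∈ fbModel d n)
    (B : Set (Fin n)) : diDist G ⟨avoid G.Adj B⟩ ≤ B.ncard * (2 * d) := by
  classical
  have hsub : symmDiff (arcSet G) (arcSet ⟨avoid G.Adj B⟩) ⊆
      ⋃ v ∈ (Set.toFinite B).toFinset, (Prod.mk v '' outNbrs G v ∪ (·, v) '' inNbrs G v) := by
    rintro ⟨a, b⟩ (⟨h1, h2⟩ | ⟨h1, h2⟩)
    · have hab : a ∈ B ∨ b ∈ B := by
        by_contra! hcon
        exact h2 ⟨h1, hcon⟩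
      rcases hab with ha | hb
      · exact Set.mem_biUnion (x := a) (by simpa using ha) (Or.inl ⟨b, h1, rfl⟩)
      · exact Set.mem_biUnion (x := b) (by simpa using hb) (Or.inr ⟨a, h1, rfl⟩)
    · exact absurd h1.1 h2
  refine (Set.ncard_le_ncard hsub).trans ((Finset.set_ncard_biUnion_le _ _).trans ?_)
  rw [Set.ncard_eq_toFinset_card B, ← smul_eq_mul]
  refine Finset.sum_le_card_nsmul _ _ _ fun v _ => (Set.ncard_union_le _ _).trans ?_
  have h1 := Set.ncard_image_le (f := Prod.mk v) (Set.toFinite (outNbrs G v))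
  have h2 := Set.ncard_image_le (f := (·, v)) (Set.toFinite (inNbrs G v))
  have := hG.2 v
  omega

theorem exists_diRSet_of_diStronglyTestable {d : ℕ} {P : ∀ n : ℕ, Set (Digraph (Fin n))}
    (hPd : IsDiProperty d P) (hP : IsDiMonotone P) (hT : DiStronglyTestable d P) {ε : ℝ}
    (hε : 0 < ε) :
    ∃ r : ℕ, ∀ n : ℕ, ∃ 𝓗 : Set (Σ k : ℕ, Digraph (Fin k)), IsDiRSet r 𝓗 ∧
      P n ⊆ diFree d 𝓗 n ∧ SetsClose diDist d n ε (diFree d 𝓗 n) (P n) := by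
  -- Testability only concerns parameters below `1`, while `ε` is arbitrary here.
  obtain ⟨q, hq⟩ := hT (min ε (1 / 2)) (by positivity)
    ((min_le_right _ _).trans_lt (by norm_num))
  refine ⟨q * (2 * d + 1), fun n => ?_⟩
  obtain ⟨T, hT⟩ := hq n
  let 𝓗 : Set (Σ k : ℕ, Digraph (Fin k)) :=
    {H | (H.1 ≤ q * (2 * d + 1) ∧ Loopless H.2) ∧ ∀ G ∈ P n, ¬ DiContains H.2 G}
  have hsub : P n ⊆ diFree d 𝓗 n := fun G hG => ⟨hPd.subset_model n hG, fun H hH => hH.2 G hG⟩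
  refine ⟨𝓗, fun H hH => hH.1, hsub, fun G hG => ?_,
    fun G hG => closeTo_of_mem hε.le (hsub hG) (diDist_self G)⟩
  by_contra hfar
  obtain ⟨S, hS, hSP⟩ := hT.exists_view_notMem (view := diView) fbOracle_diView
    (hPd.subset_model n) hG.1 fun hc => hfar (hc.mono (min_le_left _ _))
  obtain ⟨k, hk, e, he, hsupp⟩ :=
    exists_embedding_range_supports (ncard_touch_le_of_mem_fbModel hG.1) S
  -- The edges at `S`, pulled back to `Fin k`, embed in the `𝓗`-free graph `G`. They form a member
  -- of `𝓗` unless some `G'` in `P n` contains them, and the latter would put the view into `P n`.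
  refine hG.2 ⟨k, ⟨fun a b => incident G.Adj S (e a) (e b)⟩⟩
    ⟨⟨hk.trans (Nat.mul_le_mul_right _ hS), fun a ha => hG.1.1 _ ha.1⟩, fun G' hG' hc => hSP ?_⟩
    ⟨e, he, fun u v huv => huv.1⟩
  obtain ⟨σ, hσ⟩ := exists_perm_of_relEmb he hsupp hc
  exact hP.of_perm hPd hG' σ hσ

theorem diStronglyTestable_of_exists_diRSet {d : ℕ} {P : ∀ n : ℕ, Set (Digraph (Fin n))}
    (hP : IsDiMonotone P)
    (h : ∀ ε : ℝ, 0 < ε → ∃ r : ℕ, ∀ n : ℕ, ∃ 𝓗 : Set (Σ k : ℕ, Digraph (Fin k)),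
      IsDiRSet r 𝓗 ∧ P n ⊆ diFree d 𝓗 n ∧ SetsClose diDist d n (ε / 2) (diFree d 𝓗 n) (P n)) :
    DiStronglyTestable d P := by
  intro ε hε _
  obtain ⟨r, hr⟩ := h ε hε
  -- Isolating `ε / 4 * n` vertices deletes at most `ε / 2 * d * n` arcs, up to `2 * d` at each. The
  -- remaining `ε / 2` is spent on the closeness of `𝓗`-free graphs to `P n`.
  obtain ⟨q, hq⟩ := exists_isOneSidedTest (2 * d) r (ε / 4) (by positivity)
  refine ⟨q, fun n => ?_⟩
  obtain ⟨𝓗, hrset, hsub, hclose⟩ := hr n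
  refine hq n _ _ fbOracle Digraph.Adj (fun a => a.1 ∪ a.2) diView (fbModel d n) (P n) _
    {H | (⟨H.1, ⟨H.2⟩⟩ : Σ k : ℕ, Digraph (Fin k)) ∈ 𝓗} (fun _ _ => rfl)
    (fun G hG => ncard_touch_le_of_mem_fbModel hG) (fun _ _ => rfl) diView_congr
    (fun G => Digraph.ext (funext₂ fun u v => by simp [diView, incident]))
    (fun G hG S => hP.of_le hG fun u v huv => huv.1) (fun H hH => hrset _ hH)
    (fun G hG H hH hemb => (hsub hG).2 _ hH hemb) ?_
  refine fun G hG hfar => ⟨fun hy => hfar (closeTo_of_mem hε.le hy (diDist_self G)),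
    fun B hB => ?_⟩
  by_contra! hfree
  have hmem : (⟨avoid G.Adj B⟩ : Digraph (Fin n)) ∈ diFree d 𝓗 n :=
    ⟨fbModel_of_le hG fun u v huv => huv.1, fun H hH hc => hfree ⟨H.1, H.2.Adj⟩ hH hc⟩
  have hdist : (diDist G ⟨avoid G.Adj B⟩ : ℝ) ≤ ε / 2 * d * n := by
    have h1 : (diDist G ⟨avoid G.Adj B⟩ : ℝ) ≤ B.ncard * (2 * d) := by
      exact_mod_cast diDist_avoid_le hG B
    have h2 : (B.ncard : ℝ) * (2 * d) ≤ ε / 4 * n * (2 * d) := by gcongr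
    linarith
  have := CloseTo.of_dist_le diDist_triangle hdist
    (hclose.1 _ hmem)
  rw [add_halves] at this
  exact hfar this

/-! ### Undirected graphs -/

/-- The spanning subgraph of the edges with an end in `S`. -/
def undirView {V : Type} (G : SimpleGraph V) (S : Set V) : SimpleGraph V where
  Adj := incident G.Adj S
  symm := ⟨fun _ _ h => ⟨h.1.symm, h.2.symm⟩⟩
  loopless := ⟨fun _ h => G.loopless.irrefl _ h.1⟩

/-- The spanning subgraph of the edges with no end in `B`. -/
def undirAvoid {V : Type} (G : SimpleGraph V) (B : Set V) : SimpleGraph V where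
  Adj := avoid G.Adj B
  symm := ⟨fun _ _ h => ⟨h.1.symm, h.2.symm⟩⟩
  loopless := ⟨fun _ h => G.loopless.irrefl _ h.1⟩

theorem undirOracle_undirView {n : ℕ} (G : SimpleGraph (Fin n)) (S : Set (Fin n)) :
    ∀ v ∈ S, undirOracle (undirView G S) v = undirOracle G v := fun _ hv =>
  Set.ext fun _ => and_iff_left (Or.inl hv)

theorem undirView_congr {n : ℕ} (G G' : SimpleGraph (Fin n)) (S : Set (Fin n))
    (h : ∀ v ∈ S, undirOracle G v = undirOracle G' v) : undirView G S = undirView G' S := by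
  have h1 : ∀ v ∈ S, ∀ u, G.Adj v u ↔ G'.Adj v u := fun v hv u => Set.ext_iff.1 (h v hv) u
  refine SimpleGraph.ext (funext₂ fun u v => propext ?_)
  refine and_congr_left fun huv => ?_
  rcases huv with hu | hv
  · exact h1 u hu v
  · rw [G.adj_comm, G'.adj_comm]
    exact h1 v hv u

theorem setOf_touch_eq_neighborSet {V : Type} (G : SimpleGraph V) (v : V) :
    {u | Touch G.Adj v u} = G.neighborSet v :=
  Set.ext fun _ => ⟨fun h => h.elim id fun h => G.symm.symm _ _ h, Or.inl⟩

theorem undirModel_of_le {d n : ℕ} {G G' : SimpleGraph (Fin n)} (hG : G ∈ undirModel d n)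
    (h : G' ≤ G) : G' ∈ undirModel d n := fun v =>
  (Set.ncard_le_ncard fun _ hu => h hu).trans (hG v)

theorem isContained_iff_relEmb {V W : Type} {H : SimpleGraph W} {G : SimpleGraph V} :
    H.IsContained G ↔ RelEmb H.Adj G.Adj :=
  ⟨fun ⟨f⟩ => ⟨f.toHom, f.injective', fun _ _ h => f.toHom.map_rel h⟩,
    fun ⟨φ, hφ, h⟩ => ⟨⟨⟨φ, fun {a b} => h a b⟩, hφ⟩⟩⟩

theorem IsUndirMonotone.of_le {P : ∀ n : ℕ, Set (SimpleGraph (Fin n))} (hP : IsUndirMonotone P)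
    {n : ℕ} {G G' : SimpleGraph (Fin n)} (hG : G ∈ P n) (h : G' ≤ G) : G' ∈ P n := by
  induction hm : (G.edgeSet \ G'.edgeSet).ncard using Nat.strong_induction_on generalizing G with
  | _ m ih =>
    by_cases hle : G.edgeSet ⊆ G'.edgeSet
    · rwa [le_antisymm h (SimpleGraph.edgeSet_subset_edgeSet.1 hle)]
    · obtain ⟨e, he, he'⟩ := Set.not_subset.1 hle
      refine ih _ ?_ (hP n G hG e he) ?_ rfl
      · rw [← hm, SimpleGraph.edgeSet_deleteEdges]
        refine Set.ncard_lt_ncard ⟨fun x hx => ⟨hx.1.1, hx.2⟩, fun hsub => ?_⟩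
        exact (hsub ⟨he, he'⟩).1.2 rfl
      · rw [← SimpleGraph.edgeSet_subset_edgeSet, SimpleGraph.edgeSet_deleteEdges]
        intro x hx
        refine ⟨SimpleGraph.edgeSet_subset_edgeSet.2 h hx, ?_⟩
        rintro rfl
        exact he' hx

theorem IsUndirMonotone.of_perm {d : ℕ} {P : ∀ n : ℕ, Set (SimpleGraph (Fin n))}
    (hP : IsUndirMonotone P) (hPd : IsUndirProperty d P) {n : ℕ} {G G' : SimpleGraph (Fin n)}
    (hG : G ∈ P n) (σ : Equiv.Perm (Fin n)) (h : ∀ u v, G'.Adj u v → G.Adj (σ u) (σ v)) :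
    G' ∈ P n :=
  hP.of_le (hPd.iso_closed n G (G.comap σ) ⟨(SimpleGraph.Iso.comap σ G).symm⟩ hG)
    fun u v huv => h u v huv

theorem undirDist_self {V : Type} (G : SimpleGraph V) : undirDist G G = 0 := by simp [undirDist]

theorem undirDist_triangle {n : ℕ} (G G' G'' : SimpleGraph (Fin n)) :
    undirDist G G'' ≤ undirDist G G' + undirDist G' G'' := by
  classical
  exact ncard_symmDiff_triangle _ _ _

theorem undirDist_avoid_le {d n : ℕ} {G : SimpleGraph (Fin n)} (hG : G ∈ undirModel d n)
    (B : Set (Fin n)) : undirDist G (undirAvoid G B) ≤ B.ncard * d := by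
  classical
  have hsub : symmDiff G.edgeSet (undirAvoid G B).edgeSet ⊆
      ⋃ v ∈ (Set.toFinite B).toFinset, (fun u => s(v, u)) '' G.neighborSet v := by
    intro e
    induction e using Sym2.ind with
    | _ a b =>
    rintro (⟨h1, h2⟩ | ⟨h1, h2⟩)
    · have hab : a ∈ B ∨ b ∈ B := by
        by_contra! hcon
        exact h2 ⟨h1, hcon⟩
      rcases hab with ha | hb
      · exact Set.mem_biUnion (x := a) (by simpa using ha) ⟨b, h1, rfl⟩
      · exact Set.mem_biUnion (x := b) (by simpa using hb) ⟨a, G.symm.symm _ _ h1, Sym2.eq_swap⟩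
    · exact absurd h1.1 h2
  refine (Set.ncard_le_ncard hsub).trans ((Finset.set_ncard_biUnion_le _ _).trans ?_)
  rw [Set.ncard_eq_toFinset_card B, ← smul_eq_mul]
  exact Finset.sum_le_card_nsmul _ _ _ fun v _ =>
    (Set.ncard_image_le (Set.toFinite _)).trans (hG v)

theorem exists_undirRSet_of_undirStronglyTestable {d : ℕ}
    {P : ∀ n : ℕ, Set (SimpleGraph (Fin n))} (hPd : IsUndirProperty d P) (hP : IsUndirMonotone P)
    (hT : UndirStronglyTestable d P) {ε : ℝ} (hε : 0 < ε) :
    ∃ r : ℕ, ∀ n : ℕ, ∃ 𝓗 : Set (Σ k : ℕ, SimpleGraph (Fin k)), IsUndirRSet r 𝓗 ∧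
      P n ⊆ undirFree d 𝓗 n ∧ SetsClose undirDist d n ε (undirFree d 𝓗 n) (P n) := by
  obtain ⟨q, hq⟩ := hT (min ε (1 / 2)) (by positivity)
    ((min_le_right _ _).trans_lt (by norm_num))
  refine ⟨q * (d + 1), fun n => ?_⟩
  obtain ⟨T, hT⟩ := hq n
  let 𝓗 : Set (Σ k : ℕ, SimpleGraph (Fin k)) :=
    {H | H.1 ≤ q * (d + 1) ∧ ∀ G ∈ P n, ¬ H.2.IsContained G}
  have hsub : P n ⊆ undirFree d 𝓗 n := fun G hG => ⟨hPd.subset_model n hG, fun H hH => hH.2 G hG⟩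
  refine ⟨𝓗, fun H hH => hH.1, hsub, fun G hG => ?_,
    fun G hG => closeTo_of_mem hε.le (hsub hG) (undirDist_self G)⟩
  by_contra hfar
  obtain ⟨S, hS, hSP⟩ := hT.exists_view_notMem (view := undirView) undirOracle_undirView
    (hPd.subset_model n) hG.1 fun hc => hfar (hc.mono (min_le_left _ _))
  obtain ⟨k, hk, e, he, hsupp⟩ := exists_embedding_range_supports (R := G.Adj) (D := d)
    (fun v => by rw [setOf_touch_eq_neighborSet]; exact hG.1 v) S
  refine hG.2 ⟨k, (undirView G S).comap e⟩
    ⟨hk.trans (Nat.mul_le_mul_right _ hS), fun G' hG' hc => hSP ?_⟩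
    (isContained_iff_relEmb.2 ⟨e, he, fun u v huv => huv.1⟩)
  obtain ⟨σ, hσ⟩ := exists_perm_of_relEmb (Q := (undirView G S).Adj) he hsupp
    (isContained_iff_relEmb.1 hc)
  exact hP.of_perm hPd hG' σ hσ

theorem undirStronglyTestable_of_exists_undirRSet {d : ℕ}
    {P : ∀ n : ℕ, Set (SimpleGraph (Fin n))} (hP : IsUndirMonotone P)
    (h : ∀ ε : ℝ, 0 < ε → ∃ r : ℕ, ∀ n : ℕ, ∃ 𝓗 : Set (Σ k : ℕ, SimpleGraph (Fin k)),
      IsUndirRSet r 𝓗 ∧ P n ⊆ undirFree d 𝓗 n ∧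
        SetsClose undirDist d n (ε / 2) (undirFree d 𝓗 n) (P n)) :
    UndirStronglyTestable d P := by
  intro ε hε _
  obtain ⟨r, hr⟩ := h ε hε
  -- At most `d` edges are lost per isolated vertex, so `ε / 4` leaves slack here.
  obtain ⟨q, hq⟩ := exists_isOneSidedTest d r (ε / 4) (by positivity)
  refine ⟨q, fun n => ?_⟩
  obtain ⟨𝓗, hrset, hsub, hclose⟩ := hr n
  refine hq n _ _ undirOracle SimpleGraph.Adj id undirView (undirModel d n) (P n) _
    {H | ∃ H' ∈ 𝓗, H = ⟨H'.1, H'.2.Adj⟩} (fun G v => (setOf_touch_eq_neighborSet G v).symm)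
    (fun G hG v => by rw [setOf_touch_eq_neighborSet]; exact hG v) (fun _ _ => rfl)
    undirView_congr
    (fun G => SimpleGraph.ext (funext₂ fun u v => by simp [undirView, incident]))
    (fun G hG S => hP.of_le hG fun u v huv => huv.1) ?_ ?_ ?_
  · rintro _ ⟨H, hH, rfl⟩
    exact ⟨hrset H hH, fun v => H.2.loopless.irrefl v⟩
  · rintro G hG _ ⟨H, hH, rfl⟩ hemb
    exact (hsub hG).2 H hH (isContained_iff_relEmb.2 hemb)
  refine fun G hG hfar => ⟨fun hy => hfar (closeTo_of_mem hε.le hy (undirDist_self G)),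
    fun B hB => ?_⟩
  by_contra! hfree
  have hmem : undirAvoid G B ∈ undirFree d 𝓗 n :=
    ⟨undirModel_of_le hG fun u v huv => huv.1, fun H hH hc =>
      hfree ⟨H.1, H.2.Adj⟩ ⟨H, hH, rfl⟩ (isContained_iff_relEmb.1 hc)⟩
  have hdist : (undirDist G (undirAvoid G B) : ℝ) ≤ ε / 2 * d * n := by
    have h1 : (undirDist G (undirAvoid G B) : ℝ) ≤ B.ncard * d := by
      exact_mod_cast undirDist_avoid_le hG B
    have h2 : (B.ncard : ℝ) * d ≤ ε / 4 * n * d := by gcongr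
    have h3 : 0 ≤ ε / 4 * n * d := by positivity
    linarith
  have := CloseTo.of_dist_le undirDist_triangle hdist
    (hclose.1 _ hmem)
  rw [add_halves] at this
  exact hfar this

end FBTesting

theorem theorem6p3 (d : ℕ) :
    (∀ P : ∀ n : ℕ, Set (Digraph (Fin n)),
      FBTesting.IsDiProperty d P → FBTesting.IsDiMonotone P →
      (FBTesting.DiStronglyTestable d P ↔
        ∀ ε : ℝ, 0 < ε → ∃ r : ℕ, ∀ n : ℕ,
          ∃ 𝓗 : Set (Σ k : ℕ, Digraph (Fin k)), FBTesting.IsDiRSet r 𝓗 ∧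
            P n ⊆ FBTesting.diFree d 𝓗 n ∧
            FBTesting.SetsClose FBTesting.diDist d n (ε / 2) (FBTesting.diFree d 𝓗 n) (P n))) ∧
    (∀ P : ∀ n : ℕ, Set (SimpleGraph (Fin n)),
      FBTesting.IsUndirProperty d P → FBTesting.IsUndirMonotone P →
      (FBTesting.UndirStronglyTestable d P ↔
        ∀ ε : ℝ, 0 < ε → ∃ r : ℕ, ∀ n : ℕ,
          ∃ 𝓗 : Set (Σ k : ℕ, SimpleGraph (Fin k)), FBTesting.IsUndirRSet r 𝓗 ∧
            P n ⊆ FBTesting.undirFree d 𝓗 n ∧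
            FBTesting.SetsClose FBTesting.undirDist d n (ε / 2)
              (FBTesting.undirFree d 𝓗 n) (P n))) := by
  refine ⟨fun P hPd hP => ⟨fun hT ε hε => ?_, ?_⟩, fun P hPd hP => ⟨fun hT ε hε => ?_, ?_⟩⟩
  · exact FBTesting.exists_diRSet_of_diStronglyTestable hPd hP hT (half_pos hε)
  · exact FBTesting.diStronglyTestable_of_exists_diRSet hP
  · exact FBTesting.exists_undirRSet_of_undirStronglyTestable hPd hP hT (half_pos hε)
  · exact FBTesting.undirStronglyTestable_of_exists_undirRSet hP
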